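/- Let $a_n>0$, $b_n\in\mathbb R$ ($n\ge 0$) and let $\mathcal J$ be the Jacobi matrix $(\mathcal J u)_0=b_0u_0+a_0u_1$, $(\mathcal J u)_n=a_{n-1}u_{n-1}+b_nu_n+a_nu_{n+1}$ ($n\ge1$). In $\ell^2(\mathbb Z_+)$, with $\langle u,v\rangle=\sum_n u_n\bar v_n$, let $J_{\min}u=\mathcal Ju$ on finitely supported $u$ and $J_{\max}u=\mathcal Ju$ on $\{u\in\ell^2:\mathcal Ju\in\ell^2\}$, and let $\mathsf D$ be the domain of the closure of $J_{\min}$. For $z\in\mathbb C$ let $p(z)=(p_n(z))$, $q(z)=(q_n(z))$ be the solutions of $a_{n-1}u_{n-1}+b_nu_n+a_nu_{n+1}=zu_n$ ($n\ge1$) with $p_0=1$, $p_1=(z-b_0)/a_0$, $q_0=0$, $q_1=1/a_0$. Assume the limit circle case: the closure of $J_{\min}$ is different from $J_{\max}$. Then $p(z),q(z)\in\ell^2$ for all $z\in\mathbb C$. For $t\in\mathbb R\cup\{\infty\}$ let $J_t$ be the restriction of $J_{\max}$ to $$\mathcal D(J_t)=\mathsf D\dotplus\mathbb C\,(t\,p(0)+q(0))\quad(t\in\mathbb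 R),\qquad \mathcal D(J_\infty)=\mathsf D\dotplus\mathbb C\,p(0)$$ (the sums are direct). Each $J_t$ is a self-adjoint extension of $J_{\min}$, and for all $z$ with $\operatorname{Im}z\ne0$ its resolvent $R_t(z)=(J_t-zI)^{-1}$ is a bounded everywhere defined operator, given for all $h\in\ell^2$ by $$R_t(z)h=\gamma_t(z)\,\langle h,p(\bar z)\rangle\,p(z)+\mathcal R(z)h,$$ where $$(\mathcal R(z)h)_n=q_n(z)\sum_{m=0}^{n}p_m(z)h_m+p_n(z)\sum_{m=n+1}^\infty q_m(z)h_m,$$ $$\gamma_t(z)=\frac{z\langle q(z),q(0)\rangle+\bigl(1+z\langle q(z),p(0)\rangle\bigr)t}{1-z\langle p(z),q(0)\rangle-z\langle p(z),p(0)\rangle t}\quad(t\in\mathbb R),\qquad \gamma_\infty(z)=-\frac{1+z\langle q(z),p(0)\rangle}{z\langle p(z),p(0)\rangle},$$ and all these denominators are nonzero. Moreover, for each such $z$, $t\mapsto\gamma_t(z)$ is a Möbius function: its determinant $$\bigl(1+z\langle q(z),p(0)\rangle\bigr)\bigl(1-z\langle p(z),q(0)\rangle\bigr)+z\langle q(z),q(0)\rangle\cdot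 z\langle p(z),p(0)\rangle$$ is nonzero. -/

import Mathlib

open scoped ComplexConjugate

/-- The Hilbert space `ℓ²(ℤ₊)` of square-summable complex sequences. -/
abbrev EllTwo : Type := lp (fun _ : ℕ => ℂ) 2

/-- A vector of `ℓ²`, seen as a sequence. -/
def EllTwo.toSeq : EllTwo →ₗ[ℂ] (ℕ → ℂ) where
  toFun u := fun n => u n
  map_add' _ _ := rfl
  map_smul' _ _ := rfl

/-- The scalar product `⟨u, v⟩ = ∑ uₙ v̄ₙ`, linear in the first argument. -/
noncomputable def scalarProd (u v : ℕ → ℂ) : ℂ := ∑' n, u n * conj (v n)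

/-- The formal action `u ↦ 𝒥 u` of the Jacobi matrix with off-diagonal entries `a` and diagonal
entries `b` on an arbitrary sequence. -/
noncomputable def jacobiAction (a b : ℕ → ℝ) : (ℕ → ℂ) →ₗ[ℂ] (ℕ → ℂ) where
  toFun u
    | 0 => b 0 * u 0 + a 0 * u 1
    | n + 1 => a n * u n + b (n + 1) * u (n + 1) + a (n + 1) * u (n + 2)
  map_add' u v := by
    funext n
    cases n <;> simp only [Pi.add_apply] <;> ring
  map_smul' c u := by
    funext n
    cases n <;> simp only [Pi.smul_apply, smul_eq_mul, RingHom.id_apply] <;> ring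

/-- The orthogonal polynomials of the first kind `pₙ(z)`. -/
noncomputable def jacobiP (a b : ℕ → ℝ) (z : ℂ) : ℕ → ℂ
  | 0 => 1
  | 1 => (z - b 0) / a 0
  | n + 2 => ((z - b (n + 1)) * jacobiP a b z (n + 1) - a n * jacobiP a b z n) / a (n + 1)

/-- The orthogonal polynomials of the second kind `qₙ(z)`. -/
noncomputable def jacobiQ (a b : ℕ → ℝ) (z : ℂ) : ℕ → ℂ
  | 0 => 0
  | 1 => 1 / a 0
  | n + 2 => ((z - b (n + 1)) * jacobiQ a b z (n + 1) - a n * jacobiQ a b z n) / a (n + 1)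

/-- A finitely supported sequence is square-summable. -/
theorem memℓp_two_of_finite_support (u : ℕ → ℂ) (hu : {n | u n ≠ 0}.Finite) :
    Memℓp (E := fun _ : ℕ => ℂ) u 2 :=
  (memℓp_zero hu).of_exponent_ge (by simp)

/-- The Jacobi matrix maps finitely supported sequences to finitely supported ones. -/
theorem finite_support_jacobiAction (a b : ℕ → ℝ) (u : ℕ → ℂ) (hu : {n | u n ≠ 0}.Finite) :
    {n | jacobiAction a b u n ≠ 0}.Finite := by
  obtain ⟨N, hN⟩ := hu.bddAbove
  refine (Set.finite_Iic (N + 1)).subset fun n hn => ?_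
  by_contra hlt
  have hlt : N + 1 < n := by simpa using hlt
  have h0 : ∀ m, N < m → u m = 0 := fun m hm => by
    by_contra h
    exact absurd (hN h) (by omega)
  apply hn
  obtain _ | k := n
  · omega
  · simp [jacobiAction, h0 k (by omega), h0 (k + 1) (by omega), h0 (k + 2) (by omega)]

/-- The minimal Jacobi operator: `u ↦ 𝒥 u` on the finitely supported vectors. -/
noncomputable def jacobiMin (a b : ℕ → ℝ) : EllTwo →ₗ.[ℂ] EllTwo where
  domain :=
    { carrier := {u | {n | u n ≠ 0}.Finite}
      zero_mem' := by simp
      add_mem' := fun {u v} hu hv => (Set.Finite.union hu hv).subset fun n hn => by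
        by_contra h
        simp only [Set.mem_union, Set.mem_ofPred_eq, not_or, not_not] at h
        exact hn (by simp [h.1, h.2])
      smul_mem' := fun c u hu => Set.Finite.subset hu fun n hn h => hn (by simp [h]) }
  toFun :=
    { toFun := fun u => ⟨jacobiAction a b (EllTwo.toSeq u),
        memℓp_two_of_finite_support _ (finite_support_jacobiAction a b _ u.2)⟩
      map_add' := fun u v => by
        apply Subtype.ext
        exact map_add (jacobiAction a b) (EllTwo.toSeq u) (EllTwo.toSeq v)
      map_smul' := fun c u => by
        apply Subtype.ext
        exact map_smul (jacobiAction a b) c (EllTwo.toSeq u) }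

/-- The maximal Jacobi operator: `u ↦ 𝒥 u` on all `u ∈ ℓ²` with `𝒥 u ∈ ℓ²`. -/
noncomputable def jacobiMax (a b : ℕ → ℝ) : EllTwo →ₗ.[ℂ] EllTwo where
  domain :=
    { carrier := {u | Memℓp (E := fun _ : ℕ => ℂ) (jacobiAction a b (EllTwo.toSeq u)) 2}
      zero_mem' := by
        simp only [Set.mem_ofPred_eq, map_zero]
        exact zero_memℓp
      add_mem' := fun {u v} hu hv => by
        simp only [Set.mem_ofPred_eq, map_add] at *
        exact hu.add hv
      smul_mem' := fun c u hu => by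
        simp only [Set.mem_ofPred_eq, map_smul] at *
        exact hu.const_smul c }
  toFun :=
    { toFun := fun u => ⟨jacobiAction a b (EllTwo.toSeq u), u.2⟩
      map_add' := fun u v => by
        apply Subtype.ext
        exact map_add (jacobiAction a b) (EllTwo.toSeq u) (EllTwo.toSeq v)
      map_smul' := fun c u => by
        apply Subtype.ext
        exact map_smul (jacobiAction a b) c (EllTwo.toSeq u) }

/-- The sequence `t p(0) + q(0)` for real `t`, and `p(0)` for `t = ∞`. -/
noncomputable def boundarySeq (a b : ℕ → ℝ) (t : OnePoint ℝ) : ℕ → ℂ :=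
  t.elim (jacobiP a b 0) (fun s => (s : ℂ) • jacobiP a b 0 + jacobiQ a b 0)

/-- The one-dimensional subspace of `ℓ²` spanned by the sequence `boundarySeq a b t`. (It is
`{0}` if that sequence is not square-summable, which does not happen in the limit circle case.) -/
noncomputable def boundarySpan (a b : ℕ → ℝ) (t : OnePoint ℝ) : Submodule ℂ EllTwo :=
  (Submodule.span ℂ {boundarySeq a b t}).comap EllTwo.toSeq

/-- The operator `J_t`: the restriction of the maximal Jacobi operator to the sum of the domain of
the closure of the minimal operator and the line spanned by `t p(0) + q(0)` (by `p(0)` for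
`t = ∞`). -/
noncomputable def jacobiExt (a b : ℕ → ℝ) (t : OnePoint ℝ) : EllTwo →ₗ.[ℂ] EllTwo :=
  (jacobiMax a b).domRestrict ((jacobiMin a b).closure.domain ⊔ boundarySpan a b t)

/-- `R` is the resolvent `(T - z I)⁻¹` of the (unbounded) operator `T` at the point `z`: a bounded
everywhere defined operator that is a two-sided inverse of `T - z I : 𝒟(T) → E`. -/
def IsResolventAt {E : Type*} [NormedAddCommGroup E] [NormedSpace ℂ E]
    (T : E →ₗ.[ℂ] E) (z : ℂ) (R : E →L[ℂ] E) : Prop :=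
  (∀ h : E, ∃ hR : R h ∈ T.domain, T ⟨R h, hR⟩ - z • R h = h) ∧
    ∀ u : T.domain, R (T u - z • (u : E)) = u

/-- The quasiresolvent
`(𝓡(z)h)ₙ = qₙ(z) ∑_{m ≤ n} pₘ(z) hₘ + pₙ(z) ∑_{m > n} qₘ(z) hₘ`. -/
noncomputable def quasiResolvent (a b : ℕ → ℝ) (z : ℂ) (h : ℕ → ℂ) : ℕ → ℂ := fun n =>
  jacobiQ a b z n * ∑ m ∈ Finset.range (n + 1), jacobiP a b z m * h m +
    jacobiP a b z n * ∑' m : ℕ, jacobiQ a b z (n + 1 + m) * h (n + 1 + m)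

/-- The coefficient `γ_t(z)`. -/
noncomputable def resolventCoeff (a b : ℕ → ℝ) (z : ℂ) (t : OnePoint ℝ) : ℂ :=
  t.elim
    (-((1 + z * scalarProd (jacobiQ a b z) (jacobiP a b 0)) /
      (z * scalarProd (jacobiP a b z) (jacobiP a b 0))))
    (fun s =>
      (z * scalarProd (jacobiQ a b z) (jacobiQ a b 0) +
          (1 + z * scalarProd (jacobiQ a b z) (jacobiP a b 0)) * s) /
        (1 - z * scalarProd (jacobiP a b z) (jacobiQ a b 0) -
          z * scalarProd (jacobiP a b z) (jacobiP a b 0) * s))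

/-! ### Square-summable sequences -/

/-! Everything is read off from the bilinear boundary form [u,v] = `boundaryForm a b u v`. By
Green's formula its partial sums are Wronskians, so on the maximal domain [u,v] is the limit of the
Wronskians. The Plücker identity for 2×2 minors therefore survives in the limit
(`boundaryForm_mul_boundaryForm`): the form has rank at most two, and all boundary data become
planar linear algebra.

The domain of the closure of the minimal operator is the kernel of the form
(`mem_closure_domain_iff`, a double adjoint argument). In the limit circle case the form is thus
nonzero; comparing an arbitrary solution with u, v such that [u,v] ≠ 0, a Gronwall estimate puts
p(z) and q(z) in ℓ². Since [p(z),q(z)] = 1, the form has rank exactly two. In a symplectic plane a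
line is its own annihilator, so the domain of J_t is described by the single condition [u, t p(0) +
q(0)] = 0 (or [u, p(0)] = 0). This vector is real, and self-adjointness follows.

For the resolvent, variation of constants gives 𝓡(z)h, a solution of (𝒥 - z)u = h, and other
solutions differ from it by multiples of p(z). At infinity 𝓡(z)h has the boundary data of ⟨h, p(z̄)⟩
q(z), so the boundary condition forces γ = -[q(z),·]/[p(z),·]. The denominator is nonzero because a
non-real z is not an eigenvalue. Green's formula turns these brackets into the stated scalar
products, and the determinant is the Plücker relation for p(z), q(z), p(0), q(0). -/

theorem memℓp_two_iff_summable (u : ℕ → ℂ) :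
    Memℓp (E := fun _ : ℕ => ℂ) u 2 ↔ Summable fun n => ‖u n‖ ^ 2 := by
  rw [memℓp_gen_iff (by simp)]
  simp

theorem Memℓp.summable_norm_mul {u v : ℕ → ℂ} (hu : Memℓp (E := fun _ : ℕ => ℂ) u 2)
    (hv : Memℓp (E := fun _ : ℕ => ℂ) v 2) : Summable fun n => ‖u n‖ * ‖v n‖ := by
  rw [memℓp_two_iff_summable] at hu hv
  refine Summable.of_nonneg_of_le (fun n => by positivity) (fun n => ?_) (hu.add hv)
  nlinarith [sq_nonneg (‖u n‖ - ‖v n‖), sq_nonneg (‖u n‖), sq_nonneg (‖v n‖)]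

theorem Memℓp.summable_mul {u v : ℕ → ℂ} (hu : Memℓp (E := fun _ : ℕ => ℂ) u 2)
    (hv : Memℓp (E := fun _ : ℕ => ℂ) v 2) : Summable fun n => u n * v n :=
  Summable.of_norm <| by simpa using hu.summable_norm_mul hv

theorem Memℓp.of_norm_le {u : ℕ → ℂ} {f : ℕ → ℝ} (hf : Summable fun n => f n ^ 2)
    (h : ∀ᶠ n in Filter.atTop, ‖u n‖ ≤ f n) : Memℓp (E := fun _ : ℕ => ℂ) u 2 := by
  rw [memℓp_two_iff_summable]
  refine Summable.of_norm_bounded_eventually_nat hf ?_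
  filter_upwards [h] with n hn
  rw [norm_pow, norm_norm]
  gcongr

theorem Memℓp.conj {u : ℕ → ℂ} (hu : Memℓp (E := fun _ : ℕ => ℂ) u 2) :
    Memℓp (E := fun _ : ℕ => ℂ) (fun n => conj (u n)) 2 := by
  rw [memℓp_two_iff_summable] at *
  simpa using hu

/-! ### Wronskians and the boundary form -/

/-- The Wronskian `aₙ (uₙ vₙ₊₁ - uₙ₊₁ vₙ)`. -/
noncomputable def wronskian (a : ℕ → ℝ) (u v : ℕ → ℂ) (n : ℕ) : ℂ :=
  a n * (u n * v (n + 1) - u (n + 1) * v n)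

/-- `u` and `𝒥 u` are square-summable. -/
def IsMaximal (a b : ℕ → ℝ) (u : ℕ → ℂ) : Prop :=
  Memℓp (E := fun _ : ℕ => ℂ) u 2 ∧ Memℓp (E := fun _ : ℕ => ℂ) (jacobiAction a b u) 2

/-- The boundary form `∑ (uₙ (𝒥v)ₙ - (𝒥u)ₙ vₙ)`. -/
noncomputable def boundaryForm (a b : ℕ → ℝ) (u v : ℕ → ℂ) : ℂ :=
  ∑' n, (u n * jacobiAction a b v n - jacobiAction a b u n * v n)

section

variable {a b : ℕ → ℝ} {u v w x : ℕ → ℂ} {z : ℂ}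

theorem jacobiAction_zero : jacobiAction a b u 0 = b 0 * u 0 + a 0 * u 1 := rfl

theorem jacobiAction_succ (n : ℕ) : jacobiAction a b u (n + 1) =
    a n * u n + b (n + 1) * u (n + 1) + a (n + 1) * u (n + 2) := rfl

theorem jacobiAction_conj (u : ℕ → ℂ) (n : ℕ) :
    jacobiAction a b (fun n => conj (u n)) n = conj (jacobiAction a b u n) := by
  cases n <;> simp [jacobiAction_zero, jacobiAction_succ]

theorem wronskian_succ_sub (n : ℕ) : wronskian a u v (n + 1) = wronskian a u v n +
    (u (n + 1) * jacobiAction a b v (n + 1) - jacobiAction a b u (n + 1) * v (n + 1)) := by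
  simp only [wronskian, jacobiAction_succ]
  ring

/-- Green's formula. -/
theorem sum_eq_wronskian (n : ℕ) : ∑ k ∈ Finset.range (n + 1),
    (u k * jacobiAction a b v k - jacobiAction a b u k * v k) = wronskian a u v n := by
  induction n with
  | zero =>
    simp only [wronskian, jacobiAction_zero, zero_add, Finset.range_one, Finset.sum_singleton]
    ring
  | succ n ih => rw [Finset.sum_range_succ, ih, wronskian_succ_sub (b := b)]

theorem IsMaximal.conj (hu : IsMaximal a b u) : IsMaximal a b (fun n => conj (u n)) := by
  refine ⟨hu.1.conj, ?_⟩
  have : jacobiAction a b (fun n => (starRingEnd ℂ) (u n)) =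
    fun n => (starRingEnd ℂ) (jacobiAction a b u n) := funext (jacobiAction_conj u)
  rw [this]
  exact hu.2.conj

theorem IsMaximal.add (hu : IsMaximal a b u) (hv : IsMaximal a b v) : IsMaximal a b (u + v) :=
  ⟨hu.1.add hv.1, by rw [map_add]; exact hu.2.add hv.2⟩

theorem IsMaximal.smul (hu : IsMaximal a b u) (c : ℂ) : IsMaximal a b (c • u) :=
  ⟨hu.1.const_smul c, by rw [map_smul]; exact hu.2.const_smul c⟩

theorem IsMaximal.hasSum_boundaryForm (hu : IsMaximal a b u) (hv : IsMaximal a b v) :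
    HasSum (fun n => u n * jacobiAction a b v n - jacobiAction a b u n * v n)
      (boundaryForm a b u v) :=
  ((hu.1.summable_mul hv.2).sub (hu.2.summable_mul hv.1)).hasSum

theorem IsMaximal.tendsto_wronskian (hu : IsMaximal a b u) (hv : IsMaximal a b v) :
    Filter.Tendsto (wronskian a u v) Filter.atTop (nhds (boundaryForm a b u v)) := by
  have h := (Filter.tendsto_add_atTop_iff_nat 1).2 (hu.hasSum_boundaryForm hv).tendsto_sum_nat
  simpa only [sum_eq_wronskian] using h

theorem boundaryForm_antisymm (u v : ℕ → ℂ) : boundaryForm a b u v = -boundaryForm a b v u := by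
  rw [boundaryForm, boundaryForm, ← tsum_neg]
  exact tsum_congr fun n => by ring

theorem boundaryForm_self (u : ℕ → ℂ) : boundaryForm a b u u = 0 := by
  rw [boundaryForm, ← tsum_zero (α := ℂ) (β := ℕ)]
  exact tsum_congr fun n => by ring

theorem boundaryForm_conj (u v : ℕ → ℂ) :
    boundaryForm a b (fun n => conj (u n)) (fun n => conj (v n)) =
      conj (boundaryForm a b u v) := by
  simp only [boundaryForm, Complex.conj_tsum, jacobiAction_conj, map_sub, map_mul]

theorem boundaryForm_add_left (hu : IsMaximal a b u) (hv : IsMaximal a b v)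
    (hw : IsMaximal a b w) :
    boundaryForm a b (u + v) w = boundaryForm a b u w + boundaryForm a b v w := by
  rw [← ((hu.hasSum_boundaryForm hw).add (hv.hasSum_boundaryForm hw)).tsum_eq, boundaryForm]
  exact tsum_congr fun n => by simp only [map_add, Pi.add_apply]; ring

theorem boundaryForm_smul_left (c : ℂ) (u v : ℕ → ℂ) :
    boundaryForm a b (c • u) v = c * boundaryForm a b u v := by
  rw [boundaryForm, boundaryForm, ← tsum_mul_left]
  exact tsum_congr fun n => by simp only [map_smul, Pi.smul_apply, smul_eq_mul]; ring

theorem boundaryForm_add_right (hu : IsMaximal a b u) (hv : IsMaximal a b v)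
    (hw : IsMaximal a b w) :
    boundaryForm a b u (v + w) = boundaryForm a b u v + boundaryForm a b u w := by
  rw [boundaryForm_antisymm, boundaryForm_add_left hv hw hu, boundaryForm_antisymm v,
    boundaryForm_antisymm w]
  ring

theorem boundaryForm_smul_right (c : ℂ) (u v : ℕ → ℂ) :
    boundaryForm a b u (c • v) = c * boundaryForm a b u v := by
  rw [boundaryForm_antisymm, boundaryForm_smul_left, boundaryForm_antisymm v]
  ring

/-- The Plücker relation between boundary forms. -/
theorem boundaryForm_mul_boundaryForm (hu : IsMaximal a b u) (hv : IsMaximal a b v)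
    (hw : IsMaximal a b w) (hx : IsMaximal a b x) :
    boundaryForm a b u v * boundaryForm a b w x =
      boundaryForm a b u w * boundaryForm a b v x -
        boundaryForm a b u x * boundaryForm a b v w := by
  -- The identity is exact for the Wronskians at each fixed n, where it relates the 2×2 minors of
  -- four planar vectors.
  refine tendsto_nhds_unique ((hu.tendsto_wronskian hv).mul (hw.tendsto_wronskian hx))
    ((((hu.tendsto_wronskian hw).mul (hv.tendsto_wronskian hx)).sub
      ((hu.tendsto_wronskian hx).mul (hv.tendsto_wronskian hw))).congr fun n => ?_)
  simp only [wronskian]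
  ring

/-! ### Solutions of the recurrence in the limit circle case -/

/-- Cramer's rule: the vector (wₙ, wₙ₊₁) is a combination of those of u and v, with quotients of
Wronskians as coefficients. -/
theorem norm_le_of_wronskian_bound {δ : ℝ} (hδ : 0 < δ) {n : ℕ}
    (h : δ ≤ ‖wronskian a u v n‖) :
    ‖w (n + 1)‖ ≤ δ⁻¹ * (‖u (n + 1)‖ + ‖v (n + 1)‖) *
      (‖wronskian a w v n‖ + ‖wronskian a u w n‖) := by
  have key : wronskian a u v n * w (n + 1) =
      wronskian a w v n * u (n + 1) + wronskian a u w n * v (n + 1) := by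
    simp only [wronskian]
    ring
  have h1 : ‖wronskian a u v n‖ * ‖w (n + 1)‖ ≤
      ‖wronskian a w v n‖ * ‖u (n + 1)‖ + ‖wronskian a u w n‖ * ‖v (n + 1)‖ := by
    rw [← norm_mul, key, ← norm_mul, ← norm_mul]
    exact norm_add_le _ _
  have h2 : δ * ‖w (n + 1)‖ ≤ (‖u (n + 1)‖ + ‖v (n + 1)‖) *
      (‖wronskian a w v n‖ + ‖wronskian a u w n‖) := by
    have h3 : δ * ‖w (n + 1)‖ ≤ ‖wronskian a u v n‖ * ‖w (n + 1)‖ := by gcongr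
    have h4 : 0 ≤ ‖wronskian a w v n‖ * ‖v (n + 1)‖ := by positivity
    have h5 : 0 ≤ ‖wronskian a u w n‖ * ‖u (n + 1)‖ := by positivity
    linarith
  rw [mul_assoc, inv_mul_eq_div, le_div_iff₀ hδ]
  linarith

/-- A multiplicative Gronwall inequality. -/
theorem exists_bound_of_le_one_add_mul {X s : ℕ → ℝ} (hX : ∀ n, 0 ≤ X n) (hs : ∀ n, 0 ≤ s n)
    (hsum : Summable s) {N : ℕ} (h : ∀ n, N ≤ n → X (n + 1) ≤ (1 + s n) * X n) :
    ∃ C, ∀ n, N ≤ n → X n ≤ C := by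
  have key : ∀ n, N ≤ n → X n ≤ X N * Real.exp (∑ k ∈ Finset.range n, s k) := by
    intro n hn
    induction n, hn using Nat.le_induction with
    | base =>
      exact le_mul_of_one_le_right (hX N)
        (Real.one_le_exp (Finset.sum_nonneg fun k _ => hs k))
    | succ n hn ih =>
      rw [Finset.sum_range_succ, Real.exp_add]
      have h1 : 1 + s n ≤ Real.exp (s n) := by linarith [Real.add_one_le_exp (s n)]
      calc X (n + 1) ≤ (1 + s n) * X n := h n hn
        _ ≤ Real.exp (s n) * (X N * Real.exp (∑ k ∈ Finset.range n, s k)) := by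
            gcongr
            exact hX n
        _ = _ := by ring
  refine ⟨X N * Real.exp (∑' k, s k), fun n hn => (key n hn).trans ?_⟩
  have := hX N
  gcongr
  exact hsum.sum_le_tsum _ fun k _ => hs k

/-- If the boundary form does not vanish identically, all solutions of the eigenvalue recurrence
are square-summable. -/
theorem memℓp_of_boundaryForm_ne_zero (hu : IsMaximal a b u) (hv : IsMaximal a b v)
    (huv : boundaryForm a b u v ≠ 0)
    (hw : ∀ n, jacobiAction a b w (n + 1) = z * w (n + 1)) :
    Memℓp (E := fun _ : ℕ => ℂ) w 2 := by
  -- Half the limit is a lower bound for the Wronskian of u and v from some index on, which makes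
  -- Cramer's rule uniform.
  set δ := ‖boundaryForm a b u v‖ / 2 with hδ_def
  have hδ : 0 < δ := by positivity
  obtain ⟨N, hN⟩ := Filter.eventually_atTop.1 <|
    (hu.tendsto_wronskian hv).norm.eventually_const_le
      (show δ < ‖boundaryForm a b u v‖ by rw [hδ_def]; linarith)
  set X : ℕ → ℝ := fun n => ‖wronskian a w v n‖ + ‖wronskian a u w n‖ with hX
  -- The square-summable defects f and g measure how far u and v are from solving the recurrence.
  -- They drive the increments of the two Wronskians in X, with a summable rate s by Cauchy–Schwarz,
  -- so X stays bounded.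
  set f : ℕ → ℂ := jacobiAction a b u - z • u with hf
  set g : ℕ → ℂ := jacobiAction a b v - z • v with hg
  have hf2 : Memℓp (E := fun _ : ℕ => ℂ) f 2 := hu.2.sub (hu.1.const_smul z)
  have hg2 : Memℓp (E := fun _ : ℕ => ℂ) g 2 := hv.2.sub (hv.1.const_smul z)
  set s : ℕ → ℝ := fun n => δ⁻¹ * ((‖u n‖ + ‖v n‖) * (‖f n‖ + ‖g n‖)) with hs
  have hs_sum : Summable s := by
    refine Summable.mul_left _ ?_
    refine ((hu.1.summable_norm_mul hf2).add ((hu.1.summable_norm_mul hg2).add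
      ((hv.1.summable_norm_mul hf2).add (hv.1.summable_norm_mul hg2)))).congr fun n => ?_
    ring
  have hbound : ∀ n, N ≤ n → ‖w (n + 1)‖ ≤ δ⁻¹ * (‖u (n + 1)‖ + ‖v (n + 1)‖) * X n :=
    fun n hn => norm_le_of_wronskian_bound hδ (hN n hn)
  have hstep : ∀ n, N ≤ n → X (n + 1) ≤ (1 + s (n + 1)) * X n := by
    intro n hn
    have h1 : wronskian a w v (n + 1) = wronskian a w v n + w (n + 1) * g (n + 1) := by
      rw [wronskian_succ_sub (b := b), hw, hg]
      simp only [Pi.sub_apply, Pi.smul_apply, smul_eq_mul]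
      ring
    have h2 : wronskian a u w (n + 1) = wronskian a u w n - w (n + 1) * f (n + 1) := by
      rw [wronskian_succ_sub (b := b), hw, hf]
      simp only [Pi.sub_apply, Pi.smul_apply, smul_eq_mul]
      ring
    have h3 := norm_add_le (wronskian a w v n) (w (n + 1) * g (n + 1))
    have h4 := norm_sub_le (wronskian a u w n) (w (n + 1) * f (n + 1))
    rw [← h1, norm_mul] at h3
    rw [← h2, norm_mul] at h4
    have h5 : ‖w (n + 1)‖ * (‖f (n + 1)‖ + ‖g (n + 1)‖) ≤
        δ⁻¹ * (‖u (n + 1)‖ + ‖v (n + 1)‖) * X n * (‖f (n + 1)‖ + ‖g (n + 1)‖) := by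
      gcongr
      exact hbound n hn
    simp only [hX, hs] at h5 ⊢
    linarith
  obtain ⟨C, hC⟩ := exists_bound_of_le_one_add_mul (s := fun n => s (n + 1))
    (fun n => by positivity) (fun n => by positivity)
    ((summable_nat_add_iff 1).2 hs_sum) hstep
  have hsq : Summable fun n => (δ⁻¹ * (‖u n‖ + ‖v n‖) * C) ^ 2 := by
    refine Summable.congr (Summable.mul_left ((δ⁻¹ * C) ^ 2) ((hu.1.summable_norm_mul hu.1).add
      ((hv.1.summable_norm_mul hv.1).add ((hu.1.summable_norm_mul hv.1).mul_left 2)))) fun n => ?_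
    ring
  refine Memℓp.of_norm_le hsq ?_
  filter_upwards [Filter.eventually_ge_atTop (N + 1)] with n hn
  obtain ⟨m, rfl⟩ : ∃ m, n = m + 1 := ⟨n - 1, by omega⟩
  refine (hbound m (by omega)).trans ?_
  gcongr
  exact hC m (by omega)

/-! ### The orthogonal polynomials -/

theorem jacobiAction_jacobiP (ha : ∀ n, 0 < a n) (z : ℂ) :
    jacobiAction a b (jacobiP a b z) = z • jacobiP a b z := by
  have ha' : ∀ n, (a n : ℂ) ≠ 0 := fun n => by exact_mod_cast (ha n).ne'
  funext n
  cases n with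
  | zero =>
    have := ha' 0
    simp only [jacobiAction_zero, jacobiP, Pi.smul_apply, smul_eq_mul]
    field_simp
    ring
  | succ n =>
    have := ha' (n + 1)
    simp only [jacobiAction_succ, jacobiP, Pi.smul_apply, smul_eq_mul]
    field_simp
    ring

theorem jacobiAction_jacobiQ_zero (ha : ∀ n, 0 < a n) (z : ℂ) :
    jacobiAction a b (jacobiQ a b z) 0 = 1 := by
  have : (a 0 : ℂ) ≠ 0 := by exact_mod_cast (ha 0).ne'
  simp [jacobiAction_zero, jacobiQ, this]

theorem jacobiAction_jacobiQ_succ (ha : ∀ n, 0 < a n) (z : ℂ) (n : ℕ) :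
    jacobiAction a b (jacobiQ a b z) (n + 1) = z * jacobiQ a b z (n + 1) := by
  have : (a (n + 1) : ℂ) ≠ 0 := by exact_mod_cast (ha (n + 1)).ne'
  simp only [jacobiAction_succ, jacobiQ]
  field_simp
  ring

theorem jacobiAction_jacobiQ (ha : ∀ n, 0 < a n) (z : ℂ) :
    jacobiAction a b (jacobiQ a b z) = z • jacobiQ a b z + Pi.single 0 1 := by
  funext n
  cases n with
  | zero => simp [jacobiAction_jacobiQ_zero ha, jacobiQ]
  | succ n => simp [jacobiAction_jacobiQ_succ ha]

theorem wronskian_jacobiP_jacobiQ (ha : ∀ n, 0 < a n) (z : ℂ) (n : ℕ) :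
    wronskian a (jacobiP a b z) (jacobiQ a b z) n = 1 := by
  induction n with
  | zero =>
    have : (a 0 : ℂ) ≠ 0 := by exact_mod_cast (ha 0).ne'
    simp [wronskian, jacobiQ, jacobiP, this]
  | succ n ih =>
    rw [wronskian_succ_sub (b := b), ih, jacobiAction_jacobiQ_succ ha, jacobiAction_jacobiP ha,
      Pi.smul_apply, smul_eq_mul]
    ring

theorem jacobiP_conj (z : ℂ) (n : ℕ) : jacobiP a b (conj z) n = conj (jacobiP a b z n) := by
  induction n using Nat.twoStepInduction with
  | zero => simp [jacobiP]
  | one => simp [jacobiP]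
  | more n h1 h2 => simp [jacobiP, h1, h2]

theorem jacobiQ_conj (z : ℂ) (n : ℕ) : jacobiQ a b (conj z) n = conj (jacobiQ a b z n) := by
  induction n using Nat.twoStepInduction with
  | zero => simp [jacobiQ]
  | one => simp [jacobiQ]
  | more n h1 h2 => simp [jacobiQ, h1, h2]

/-- A solution of `𝒥 u = z u` is a multiple of `p(z)`. -/
theorem eq_smul_jacobiP (ha : ∀ n, 0 < a n) (hu : jacobiAction a b u = z • u) :
    u = u 0 • jacobiP a b z := by
  have ha' : ∀ n, (a n : ℂ) ≠ 0 := fun n => by exact_mod_cast (ha n).ne'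
  funext n
  induction n using Nat.twoStepInduction with
  | zero => simp [jacobiP]
  | one =>
    have h := congrFun hu 0
    have := ha' 0
    simp only [jacobiAction_zero, Pi.smul_apply, smul_eq_mul, jacobiP] at h ⊢
    field_simp
    linear_combination h
  | more n h1 h2 =>
    have h := congrFun hu (n + 1)
    have := ha' (n + 1)
    simp only [jacobiAction_succ, Pi.smul_apply, smul_eq_mul, jacobiP] at h h1 h2 ⊢
    field_simp
    rw [h1, h2] at h
    linear_combination h

end

/-! ### The closure of an operator and its second adjoint -/

/-- A pair orthogonal (in the sense of adjoints) to the adjoint of `g` lies in the closure of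
`g`. -/
theorem Submodule.mem_topologicalClosure_of_forall_mem_adjoint {E F : Type*}
    [NormedAddCommGroup E] [InnerProductSpace ℂ E] [CompleteSpace E]
    [NormedAddCommGroup F] [InnerProductSpace ℂ F] [CompleteSpace F]
    (g : Submodule ℂ (E × F)) (x : E) (y : F)
    (h : ∀ v w, (v, w) ∈ g.adjoint → inner ℂ w x = inner ℂ v y) :
    (x, y) ∈ g.topologicalClosure := by
  -- The plain product carries the sup norm. Passing to the ℓ² product makes orthogonal complements
  -- available, where Kᗮᗮ is the closure of K.
  set K : Submodule ℂ (WithLp 2 (E × F)) :=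
    g.map (WithLp.linearEquiv 2 ℂ (E × F)).symm.toLinearMap with hK
  have hmem : WithLp.toLp 2 (x, y) ∈ Kᗮᗮ := by
    rw [Submodule.mem_orthogonal]
    intro w hw
    rw [Submodule.mem_orthogonal] at hw
    -- The graph of the adjoint is the orthogonal complement of the graph, rotated by (x, y) ↦ (y,
    -- -x).
    have hadj : (w.snd, -w.fst) ∈ g.adjoint := by
      rw [Submodule.mem_adjoint_iff]
      intro a b hab
      have h1 := hw (WithLp.toLp 2 (a, b)) ⟨(a, b), hab, rfl⟩
      rw [WithLp.prod_inner_apply] at h1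
      simp only [inner_neg_right, sub_neg_eq_add]
      rw [add_comm]
      exact h1
    have h2 := h _ _ hadj
    rw [inner_neg_left] at h2
    rw [WithLp.prod_inner_apply]
    change inner ℂ w.fst x + inner ℂ w.snd y = 0
    rw [← h2]
    ring
  rw [Submodule.orthogonal_orthogonal_eq_closure] at hmem
  have h3 : WithLp.toLp 2 (x, y) ∈ closure (K : Set (WithLp 2 (E × F))) := hmem
  have h4 := map_mem_closure (WithLp.prod_continuous_ofLp 2 E F) h3
    (t := (g : Set (E × F))) (by
      rintro _ ⟨p, hp, rfl⟩
      exact hp)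
  exact h4

/-! ### The minimal and maximal Jacobi operators -/

section

variable {a b : ℕ → ℝ}

theorem mem_jacobiMax_domain_iff {u : EllTwo} :
    u ∈ (jacobiMax a b).domain ↔ IsMaximal a b (EllTwo.toSeq u) :=
  ⟨fun h => ⟨lp.memℓp u, h⟩, fun h => h.2⟩

theorem toSeq_jacobiMax (u : (jacobiMax a b).domain) :
    EllTwo.toSeq (jacobiMax a b u) = jacobiAction a b (EllTwo.toSeq u) := rfl

theorem EllTwo.toSeq_injective : Function.Injective EllTwo.toSeq :=
  fun _ _ h => lp.ext h

theorem jacobiMin_le_jacobiMax : jacobiMin a b ≤ jacobiMax a b :=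
  ⟨fun u hu => memℓp_two_of_finite_support _ (finite_support_jacobiAction a b _ hu),
    fun u v huv => EllTwo.toSeq_injective <| by
      rw [toSeq_jacobiMax, ← huv]
      rfl⟩

theorem EllTwo.inner_eq_tsum (u v : EllTwo) :
    inner ℂ u v = ∑' n, conj (EllTwo.toSeq u n) * EllTwo.toSeq v n := by
  rw [lp.inner_eq_tsum]
  exact tsum_congr fun n => by rw [RCLike.inner_apply, mul_comm]; rfl

/-- The coefficients are real, so conjugation commutes with 𝒥; it absorbs the conjugate-linearity of
`inner` in its first slot and links the adjoint to the bilinear form. -/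
theorem inner_jacobiMax_sub_inner (u v : (jacobiMax a b).domain) :
    inner ℂ (u : EllTwo) (jacobiMax a b v) - inner ℂ (jacobiMax a b u) (v : EllTwo) =
      boundaryForm a b (fun n => conj (EllTwo.toSeq u n)) (EllTwo.toSeq v) := by
  have hu := (mem_jacobiMax_domain_iff.1 u.2).conj
  have hv := mem_jacobiMax_domain_iff.1 v.2
  rw [EllTwo.inner_eq_tsum, EllTwo.inner_eq_tsum, boundaryForm, toSeq_jacobiMax, toSeq_jacobiMax,
    (hu.1.summable_mul hv.2).tsum_sub (hu.2.summable_mul hv.1)]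
  simp only [jacobiAction_conj]

theorem single_mem_jacobiMin_domain (m : ℕ) :
    (lp.single 2 m 1 : EllTwo) ∈ (jacobiMin a b).domain := by
  refine (Set.finite_singleton m).subset fun n hn => ?_
  by_contra h
  refine hn ?_
  rw [lp.single_apply]
  exact Pi.single_eq_of_ne h _

/-- The formal adjoint of the minimal operator acts as the Jacobi matrix. -/
theorem jacobiAction_eq_of_inner_eq {v w : EllTwo}
    (h : ∀ x : (jacobiMin a b).domain, inner ℂ (x : EllTwo) w = inner ℂ (jacobiMin a b x) v) :
    jacobiAction a b (EllTwo.toSeq v) = EllTwo.toSeq w := by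
  funext m
  -- Testing against the m-th basis vector isolates the m-th coordinate.
  set e : (jacobiMin a b).domain := ⟨lp.single 2 m 1, single_mem_jacobiMin_domain m⟩ with he
  have hseq : EllTwo.toSeq (e : EllTwo) = Pi.single m 1 := by
    funext n
    change (lp.single 2 m (1 : ℂ) : EllTwo) n = _
    rw [lp.single_apply]
  have h1 : inner ℂ (e : EllTwo) w = EllTwo.toSeq w m := by
    rw [EllTwo.inner_eq_tsum, hseq, tsum_eq_single m fun n hn => by simp [Pi.single_eq_of_ne hn]]
    simp
  have hmin : EllTwo.toSeq (jacobiMin a b e) = jacobiAction a b (Pi.single m 1) := by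
    rw [← hseq]
    rfl
  have hmem : Memℓp (E := fun _ : ℕ => ℂ) (jacobiAction a b (Pi.single m 1)) 2 := by
    rw [← hmin]
    exact lp.memℓp (jacobiMin a b e)
  have hconj : ∀ n, conj (jacobiAction a b (Pi.single m 1) n) =
      jacobiAction a b (Pi.single m 1) n := fun n => by
    rw [← jacobiAction_conj]
    refine congrArg (fun f => jacobiAction a b f n) (funext fun k => ?_)
    by_cases hk : k = m
    · subst hk
      simp
    · simp [Pi.single_eq_of_ne hk]
  have hs := (hmem.summable_mul (lp.memℓp v)).hasSum.tendsto_sum_nat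
  have hlim : Filter.Tendsto (fun n => ∑ k ∈ Finset.range n,
      jacobiAction a b (Pi.single m 1) k * v k) Filter.atTop
      (nhds (jacobiAction a b (EllTwo.toSeq v) m)) := by
    refine tendsto_const_nhds.congr' ?_
    filter_upwards [Filter.eventually_ge_atTop (m + 2)] with n hn
    obtain ⟨k, rfl⟩ : ∃ k, n = k + 1 := ⟨n - 1, by omega⟩
    -- Summing up to k ≥ m + 1 puts both entries of the Wronskian beyond the support of the basis
    -- vector, so Green's formula has no boundary term.
    have hg := sum_eq_wronskian (a := a) (b := b) (u := EllTwo.toSeq v) (v := Pi.single m 1) k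
    have hW : wronskian a (EllTwo.toSeq v) (Pi.single m 1) k = 0 := by
      simp [wronskian, Pi.single_eq_of_ne (show k ≠ m by omega),
        Pi.single_eq_of_ne (show k + 1 ≠ m by omega)]
    rw [hW, Finset.sum_sub_distrib, sub_eq_zero,
      Finset.sum_eq_single (s := Finset.range (k + 1)) (f := fun i =>
        jacobiAction a b (EllTwo.toSeq v) i * (Pi.single m 1 : ℕ → ℂ) i) m
        (fun i _ hi => by simp [Pi.single_eq_of_ne hi])
        (fun hm => absurd (Finset.mem_range.2 (by omega)) hm)] at hg
    rw [Pi.single_eq_same, mul_one] at hg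
    rw [← hg]
    exact Finset.sum_congr rfl fun i _ => mul_comm _ _
  rw [← h1, h e, EllTwo.inner_eq_tsum, hmin, ← tendsto_nhds_unique hs hlim]
  exact tsum_congr fun n => by rw [hconj]; rfl

theorem dense_jacobiMin_domain : Dense ((jacobiMin a b).domain : Set EllTwo) := by
  rw [Submodule.dense_iff_topologicalClosure_eq_top, Submodule.topologicalClosure_eq_top_iff,
    Submodule.eq_bot_iff]
  intro v hv
  refine lp.ext (funext fun m => ?_)
  have h := (Submodule.mem_orthogonal _ _).1 hv _ (single_mem_jacobiMin_domain m)
  rw [lp.inner_single_left] at h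
  simpa using h

theorem EllTwo.continuous_toSeq : Continuous EllTwo.toSeq :=
  continuous_pi fun n => (lp.lipschitzWith_one_eval (E := fun _ : ℕ => ℂ) 2 n).continuous

theorem continuous_jacobiAction : Continuous (jacobiAction a b) := by
  refine continuous_pi fun n => ?_
  cases n with
  | zero => simp only [jacobiAction_zero]; fun_prop
  | succ n => simp only [jacobiAction_succ]; fun_prop

theorem mem_jacobiMax_graph_iff {x : EllTwo × EllTwo} : x ∈ (jacobiMax a b).graph ↔
    jacobiAction a b (EllTwo.toSeq x.1) = EllTwo.toSeq x.2 := by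
  rw [LinearPMap.mem_graph_iff]
  constructor
  · rintro ⟨u, hu, hx⟩
    rw [← hu, ← hx, toSeq_jacobiMax]
  · intro h
    have hx : x.1 ∈ (jacobiMax a b).domain :=
      mem_jacobiMax_domain_iff.2 ⟨lp.memℓp _, by rw [h]; exact lp.memℓp _⟩
    exact ⟨⟨x.1, hx⟩, rfl, EllTwo.toSeq_injective h⟩

/-- Each coordinate of 𝒥u involves at most three coordinates of u, so the graph is cut out by
equations between continuous functions. -/
theorem isClosed_jacobiMax : (jacobiMax a b).IsClosed := by
  have h : ((jacobiMax a b).graph : Set (EllTwo × EllTwo)) =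
      {x | jacobiAction a b (EllTwo.toSeq x.1) = EllTwo.toSeq x.2} :=
    Set.ext fun x => mem_jacobiMax_graph_iff
  rw [LinearPMap.IsClosed, h]
  exact isClosed_eq
    (continuous_jacobiAction.comp (EllTwo.continuous_toSeq.comp continuous_fst))
    (EllTwo.continuous_toSeq.comp continuous_snd)

theorem isClosable_jacobiMin : (jacobiMin a b).IsClosable :=
  isClosed_jacobiMax.isClosable.leIsClosable jacobiMin_le_jacobiMax

theorem jacobiMin_closure_le_jacobiMax : (jacobiMin a b).closure ≤ jacobiMax a b := by
  refine LinearPMap.le_of_le_graph ?_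
  rw [← isClosable_jacobiMin.graph_closure_eq_closure_graph]
  exact Submodule.topologicalClosure_minimal _
    (LinearPMap.le_graph_of_le jacobiMin_le_jacobiMax) isClosed_jacobiMax

theorem boundaryForm_eq_zero_of_finite_support {u v : ℕ → ℂ} (hu : IsMaximal a b u)
    (hv : IsMaximal a b v) (hfin : {n | v n ≠ 0}.Finite) : boundaryForm a b u v = 0 := by
  obtain ⟨N, hN⟩ := hfin.bddAbove
  have h0 : ∀ m, N < m → v m = 0 := fun m hm => by
    by_contra h
    exact absurd (hN h) (by omega)
  refine tendsto_nhds_unique (hu.tendsto_wronskian hv) (tendsto_const_nhds.congr' ?_)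
  filter_upwards [Filter.eventually_gt_atTop N] with n hn
  simp [wronskian, h0 n hn, h0 (n + 1) (by omega)]

/-- The domain of the closure of the minimal operator consists of the vectors of the maximal
domain whose boundary form with all vectors of the maximal domain vanishes. -/
theorem mem_closure_domain_iff {u : EllTwo} : u ∈ (jacobiMin a b).closure.domain ↔
    IsMaximal a b (EllTwo.toSeq u) ∧
      ∀ v, IsMaximal a b v → boundaryForm a b v (EllTwo.toSeq u) = 0 := by
  constructor
  · intro hu
    have hmax : u ∈ (jacobiMax a b).domain := jacobiMin_closure_le_jacobiMax.1 hu
    refine ⟨mem_jacobiMax_domain_iff.1 hmax, fun v hv => ?_⟩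
    obtain ⟨v', hv'⟩ : ∃ v' : (jacobiMax a b).domain,
        EllTwo.toSeq v' = fun n => conj (v n) :=
      ⟨⟨⟨_, hv.conj.1⟩, hv.conj.2⟩, rfl⟩
    have hvv : (fun n => conj (EllTwo.toSeq v' n)) = v := by simp [hv']
    -- For fixed v the vanishing of the boundary form is a closed condition on the graph; it holds
    -- for finitely supported vectors and passes to the closure.
    have hcl : IsClosed {x : EllTwo × EllTwo |
        inner ℂ (v' : EllTwo) x.2 = inner ℂ (jacobiMax a b v') x.1} :=
      isClosed_eq (by fun_prop) (by fun_prop)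
    have hsub : ((jacobiMin a b).graph : Set (EllTwo × EllTwo)) ⊆ {x : EllTwo × EllTwo |
        inner ℂ (v' : EllTwo) x.2 = inner ℂ (jacobiMax a b v') x.1} := by
      intro x hx
      obtain ⟨y, hy, hy'⟩ := (LinearPMap.mem_graph_iff _).1 hx
      have hy2 := jacobiMin_le_jacobiMax.1 y.2
      have hJ : jacobiMin a b y = jacobiMax a b ⟨y, hy2⟩ := jacobiMin_le_jacobiMax.2 rfl
      rw [Set.mem_ofPred_eq, ← hy, ← hy', hJ, ← sub_eq_zero]
      refine (inner_jacobiMax_sub_inner v' ⟨y, hy2⟩).trans ?_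
      rw [hvv]
      exact boundaryForm_eq_zero_of_finite_support hv (mem_jacobiMax_domain_iff.1 hy2) y.2
    have hu2 : ((u, jacobiMax a b ⟨u, hmax⟩) : EllTwo × EllTwo) ∈
        (jacobiMin a b).closure.graph := by
      rw [← jacobiMin_closure_le_jacobiMax.2 (x := ⟨u, hu⟩) (y := ⟨u, hmax⟩) rfl]
      exact LinearPMap.mem_graph (jacobiMin a b).closure ⟨u, hu⟩
    rw [← isClosable_jacobiMin.graph_closure_eq_closure_graph] at hu2
    have h := closure_minimal hsub hcl hu2
    rw [← hvv]
    exact (inner_jacobiMax_sub_inner v' ⟨u, hmax⟩).symm.trans (sub_eq_zero.2 h)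
  · rintro ⟨hu, h⟩
    have hmax : u ∈ (jacobiMax a b).domain := mem_jacobiMax_domain_iff.2 hu
    suffices hg : ((u, jacobiMax a b ⟨u, hmax⟩) : EllTwo × EllTwo) ∈
        (jacobiMin a b).closure.graph from LinearPMap.mem_domain_of_mem_graph hg
    rw [← isClosable_jacobiMin.graph_closure_eq_closure_graph]
    refine Submodule.mem_topologicalClosure_of_forall_mem_adjoint _ _ _ fun v w hvw => ?_
    rw [Submodule.mem_adjoint_iff] at hvw
    -- The adjoint of the minimal operator is contained in the maximal one, so orthogonality to its
    -- graph is exactly vanishing of boundary forms.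
    have hJ := jacobiAction_eq_of_inner_eq (a := a) (b := b) (v := v) (w := w) fun x =>
      (sub_eq_zero.1 (hvw _ _ (LinearPMap.mem_graph _ x))).symm
    obtain ⟨v', hv', hw'⟩ := (LinearPMap.mem_graph_iff _).1
      ((mem_jacobiMax_graph_iff (x := (v, w))).2 hJ)
    change (v' : EllTwo) = v at hv'
    change jacobiMax a b v' = w at hw'
    rw [← hv', ← hw', eq_comm, ← sub_eq_zero]
    exact (inner_jacobiMax_sub_inner v' ⟨u, hmax⟩).trans
      (h _ (mem_jacobiMax_domain_iff.1 v'.2).conj)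

/-- In the limit circle case the boundary form does not vanish identically. -/
theorem exists_boundaryForm_ne_zero (hLC : (jacobiMin a b).closure ≠ jacobiMax a b) :
    ∃ u v, IsMaximal a b u ∧ IsMaximal a b v ∧ boundaryForm a b u v ≠ 0 := by
  by_contra! h
  refine hLC (LinearPMap.eq_of_le_of_domain_eq jacobiMin_closure_le_jacobiMax
    (le_antisymm jacobiMin_closure_le_jacobiMax.1 fun u hu => ?_))
  have hu' := mem_jacobiMax_domain_iff.1 hu
  exact mem_closure_domain_iff.2 ⟨hu', fun v hv => h v _ hv hu'⟩

theorem isMaximal_jacobiP (ha : ∀ n, 0 < a n)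
    (hLC : (jacobiMin a b).closure ≠ jacobiMax a b) (z : ℂ) : IsMaximal a b (jacobiP a b z) := by
  obtain ⟨u, v, hu, hv, huv⟩ := exists_boundaryForm_ne_zero hLC
  have h := memℓp_of_boundaryForm_ne_zero hu hv huv (w := jacobiP a b z) (z := z) fun n => by
    rw [jacobiAction_jacobiP ha, Pi.smul_apply, smul_eq_mul]
  exact ⟨h, by rw [jacobiAction_jacobiP ha]; exact h.const_smul z⟩

theorem isMaximal_jacobiQ (ha : ∀ n, 0 < a n)
    (hLC : (jacobiMin a b).closure ≠ jacobiMax a b) (z : ℂ) : IsMaximal a b (jacobiQ a b z) := by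
  obtain ⟨u, v, hu, hv, huv⟩ := exists_boundaryForm_ne_zero hLC
  have h := memℓp_of_boundaryForm_ne_zero hu hv huv (jacobiAction_jacobiQ_succ ha z)
  refine ⟨h, ?_⟩
  rw [jacobiAction_jacobiQ ha]
  refine (h.const_smul z).add (memℓp_two_of_finite_support _ ?_)
  refine (Set.finite_singleton 0).subset fun n hn => ?_
  by_contra h0
  exact hn (Pi.single_eq_of_ne h0 _)

end

/-! ### Self-adjoint extensions -/

section

variable {a b : ℕ → ℝ} {t : OnePoint ℝ}

theorem boundarySeq_infty : boundarySeq a b OnePoint.infty = jacobiP a b 0 := rfl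

theorem boundarySeq_coe (s : ℝ) :
    boundarySeq a b (s : OnePoint ℝ) = (s : ℂ) • jacobiP a b 0 + jacobiQ a b 0 := rfl

theorem boundarySeq_conj (n : ℕ) : conj (boundarySeq a b t n) = boundarySeq a b t n := by
  have hp : conj (jacobiP a b 0 n) = jacobiP a b 0 n := by rw [← jacobiP_conj, map_zero]
  have hq : conj (jacobiQ a b 0 n) = jacobiQ a b 0 n := by rw [← jacobiQ_conj, map_zero]
  induction t using OnePoint.rec with
  | infty => exact hp
  | coe s => simp [boundarySeq_coe, hp, hq]

theorem boundaryForm_jacobiP_jacobiQ (ha : ∀ n, 0 < a n)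
    (hLC : (jacobiMin a b).closure ≠ jacobiMax a b) (z : ℂ) :
    boundaryForm a b (jacobiP a b z) (jacobiQ a b z) = 1 :=
  tendsto_nhds_unique
    ((isMaximal_jacobiP ha hLC z).tendsto_wronskian (isMaximal_jacobiQ ha hLC z))
    (tendsto_const_nhds.congr fun n => (wronskian_jacobiP_jacobiQ ha z n).symm)

theorem isMaximal_boundarySeq (ha : ∀ n, 0 < a n)
    (hLC : (jacobiMin a b).closure ≠ jacobiMax a b) (t : OnePoint ℝ) :
    IsMaximal a b (boundarySeq a b t) := by
  induction t using OnePoint.rec with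
  | infty => exact isMaximal_jacobiP ha hLC 0
  | coe s => exact ((isMaximal_jacobiP ha hLC 0).smul s).add (isMaximal_jacobiQ ha hLC 0)

/-- A dual vector for the boundary sequence: with it, the Plücker relation can be solved for an
arbitrary [u,v]. -/
theorem exists_boundaryForm_boundarySeq_eq_one (ha : ∀ n, 0 < a n)
    (hLC : (jacobiMin a b).closure ≠ jacobiMax a b) (t : OnePoint ℝ) :
    ∃ w, IsMaximal a b w ∧ boundaryForm a b (boundarySeq a b t) w = 1 := by
  have hp := isMaximal_jacobiP ha hLC 0
  have hq := isMaximal_jacobiQ ha hLC 0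
  have hpq := boundaryForm_jacobiP_jacobiQ ha hLC 0
  induction t using OnePoint.rec with
  | infty => exact ⟨_, hq, hpq⟩
  | coe s =>
    refine ⟨(-1 : ℂ) • jacobiP a b 0, hp.smul _, ?_⟩
    rw [boundarySeq_coe, boundaryForm_smul_right, boundaryForm_add_left (hp.smul _) hq hp,
      boundaryForm_smul_left, boundaryForm_self, boundaryForm_antisymm, hpq]
    ring

/-- Sequences of the maximal domain which satisfy the boundary condition pair to zero. -/
theorem boundaryForm_eq_zero (ha : ∀ n, 0 < a n)
    (hLC : (jacobiMin a b).closure ≠ jacobiMax a b) {u v : ℕ → ℂ}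
    (hu : IsMaximal a b u) (hv : IsMaximal a b v)
    (hu0 : boundaryForm a b u (boundarySeq a b t) = 0)
    (hv0 : boundaryForm a b v (boundarySeq a b t) = 0) : boundaryForm a b u v = 0 := by
  obtain ⟨w, hw, hw1⟩ := exists_boundaryForm_boundarySeq_eq_one ha hLC t
  have h := boundaryForm_mul_boundaryForm hu hv (isMaximal_boundarySeq ha hLC t) hw
  rwa [hw1, hu0, hv0, zero_mul, mul_zero, sub_zero, mul_one] at h

theorem mem_boundarySpan_iff {u : EllTwo} :
    u ∈ boundarySpan a b t ↔ ∃ c : ℂ, c • boundarySeq a b t = EllTwo.toSeq u := by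
  rw [boundarySpan, Submodule.mem_comap, Submodule.mem_span_singleton]

/-- Modulo the kernel of the form the maximal domain is a symplectic plane, where the annihilator of
a line is the line itself. The coefficient along the line is read off by pairing with the dual
vector w. -/
theorem mem_sup_boundarySpan_iff (ha : ∀ n, 0 < a n)
    (hLC : (jacobiMin a b).closure ≠ jacobiMax a b) {u : EllTwo} :
    u ∈ (jacobiMin a b).closure.domain ⊔ boundarySpan a b t ↔
      IsMaximal a b (EllTwo.toSeq u) ∧
        boundaryForm a b (EllTwo.toSeq u) (boundarySeq a b t) = 0 := by
  have hb := isMaximal_boundarySeq ha hLC t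
  constructor
  · intro hu
    obtain ⟨x, hx, y, hy, rfl⟩ := Submodule.mem_sup.1 hu
    obtain ⟨hx1, hx2⟩ := mem_closure_domain_iff.1 hx
    obtain ⟨c, hc⟩ := mem_boundarySpan_iff.1 hy
    rw [map_add, ← hc]
    refine ⟨hx1.add (hb.smul c), ?_⟩
    rw [boundaryForm_add_left hx1 (hb.smul c) hb, boundaryForm_smul_left, boundaryForm_self,
      boundaryForm_antisymm, hx2 _ hb]
    ring
  · rintro ⟨hu, hu0⟩
    obtain ⟨w, hw, hw1⟩ := exists_boundaryForm_boundarySeq_eq_one ha hLC t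
    set c := boundaryForm a b (EllTwo.toSeq u) w with hc
    set y : EllTwo := c • (⟨boundarySeq a b t, hb.1⟩ : EllTwo) with hy
    have hyseq : EllTwo.toSeq y = c • boundarySeq a b t := rfl
    refine Submodule.mem_sup.2 ⟨u - y, ?_, y, mem_boundarySpan_iff.2 ⟨c, rfl⟩,
      sub_add_cancel _ _⟩
    have hseq : EllTwo.toSeq (u - y) = EllTwo.toSeq u + (-c) • boundarySeq a b t := by
      rw [map_sub, hyseq, neg_smul, sub_eq_add_neg]
    rw [mem_closure_domain_iff, hseq]
    refine ⟨hu.add (hb.smul _), fun v hv => ?_⟩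
    have h := boundaryForm_mul_boundaryForm hu hv hb hw
    rw [hw1, hu0, ← hc, mul_one, zero_mul, zero_sub] at h
    rw [boundaryForm_add_right hv hu (hb.smul _), boundaryForm_smul_right, boundaryForm_antisymm,
      h]
    ring

theorem jacobiExt_domain (a b : ℕ → ℝ) (ha : ∀ n, 0 < a n)
    (hLC : (jacobiMin a b).closure ≠ jacobiMax a b) (t : OnePoint ℝ) :
    (jacobiExt a b t).domain = (jacobiMin a b).closure.domain ⊔ boundarySpan a b t := by
  rw [jacobiExt, LinearPMap.domRestrict_domain]
  exact inf_eq_left.2 fun u hu =>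
    mem_jacobiMax_domain_iff.2 ((mem_sup_boundarySpan_iff ha hLC).1 hu).1

theorem mem_jacobiExt_domain_iff (ha : ∀ n, 0 < a n)
    (hLC : (jacobiMin a b).closure ≠ jacobiMax a b) {u : EllTwo} :
    u ∈ (jacobiExt a b t).domain ↔ IsMaximal a b (EllTwo.toSeq u) ∧
        boundaryForm a b (EllTwo.toSeq u) (boundarySeq a b t) = 0 := by
  rw [jacobiExt_domain a b ha hLC, mem_sup_boundarySpan_iff ha hLC]

theorem jacobiExt_le_jacobiMax : jacobiExt a b t ≤ jacobiMax a b := LinearPMap.domRestrict_le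

theorem toSeq_jacobiExt (u : (jacobiExt a b t).domain) :
    EllTwo.toSeq (jacobiExt a b t u) = jacobiAction a b (EllTwo.toSeq u) := by
  rw [jacobiExt_le_jacobiMax.2 (x := u) (y := ⟨u, jacobiExt_le_jacobiMax.1 u.2⟩) rfl,
    toSeq_jacobiMax]

theorem jacobiMin_le_jacobiExt (ha : ∀ n, 0 < a n)
    (hLC : (jacobiMin a b).closure ≠ jacobiMax a b) (t : OnePoint ℝ) :
    jacobiMin a b ≤ jacobiExt a b t := by
  refine ⟨?_, fun u v huv => EllTwo.toSeq_injective ?_⟩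
  · rw [jacobiExt_domain a b ha hLC]
    exact (LinearPMap.le_closure _).1.trans le_sup_left
  · rw [toSeq_jacobiExt, ← huv]
    rfl

theorem disjoint_closure_domain_boundarySpan (ha : ∀ n, 0 < a n)
    (hLC : (jacobiMin a b).closure ≠ jacobiMax a b) (t : OnePoint ℝ) :
    Disjoint (jacobiMin a b).closure.domain (boundarySpan a b t) := by
  rw [Submodule.disjoint_def]
  intro u hu hu'
  obtain ⟨c, hc⟩ := mem_boundarySpan_iff.1 hu'
  obtain ⟨w, hw, hw1⟩ := exists_boundaryForm_boundarySeq_eq_one ha hLC t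
  have h := (mem_closure_domain_iff.1 hu).2 w hw
  rw [← hc, boundaryForm_smul_right, boundaryForm_antisymm, hw1, mul_neg, mul_one,
    neg_eq_zero] at h
  refine EllTwo.toSeq_injective ?_
  rw [← hc, h, zero_smul, map_zero]

/-- Symmetry holds because two vectors with the same real boundary condition pair to zero.
Conversely, the adjoint acts as 𝒥, by testing on finite vectors, and testing on the boundary
sequence itself forces the boundary condition. -/
theorem isSelfAdjoint_jacobiExt (ha : ∀ n, 0 < a n)
    (hLC : (jacobiMin a b).closure ≠ jacobiMax a b) (t : OnePoint ℝ) :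
    IsSelfAdjoint (jacobiExt a b t) := by
  have hb := isMaximal_boundarySeq ha hLC t
  have hdense : Dense ((jacobiExt a b t).domain : Set EllTwo) :=
    dense_jacobiMin_domain.mono (jacobiMin_le_jacobiExt ha hLC t).1
  have hconj : (fun n => conj (boundarySeq a b t n)) = boundarySeq a b t :=
    funext boundarySeq_conj
  have hsymm : (jacobiExt a b t).IsFormalAdjoint (jacobiExt a b t) := by
    intro u v
    obtain ⟨hu, hu0⟩ := (mem_jacobiExt_domain_iff ha hLC).1 u.2
    obtain ⟨hv, hv0⟩ := (mem_jacobiExt_domain_iff ha hLC).1 v.2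
    have hu0' : boundaryForm a b (fun n => conj (EllTwo.toSeq u n)) (boundarySeq a b t) = 0 := by
      rw [← hconj, boundaryForm_conj, hu0, map_zero]
    have h := inner_jacobiMax_sub_inner ⟨u, jacobiExt_le_jacobiMax.1 u.2⟩
      ⟨v, jacobiExt_le_jacobiMax.1 v.2⟩
    rw [boundaryForm_eq_zero ha hLC hu.conj hv hu0' hv0, sub_eq_zero,
      ← jacobiExt_le_jacobiMax.2 (x := u) (y := ⟨u, jacobiExt_le_jacobiMax.1 u.2⟩) rfl,
      ← jacobiExt_le_jacobiMax.2 (x := v) (y := ⟨v, jacobiExt_le_jacobiMax.1 v.2⟩) rfl] at h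
    exact h.symm
  rw [LinearPMap.isSelfAdjoint_def]
  refine (LinearPMap.eq_of_le_of_domain_eq (hsymm.le_adjoint hdense)
    (le_antisymm (hsymm.le_adjoint hdense).1 fun v hv => ?_)).symm
  set v' : (jacobiExt a b t).adjoint.domain := ⟨v, hv⟩
  have hadj := LinearPMap.adjoint_isFormalAdjoint hdense v'
  have hJ : jacobiAction a b (EllTwo.toSeq v) =
      EllTwo.toSeq ((jacobiExt a b t).adjoint v') := by
    refine jacobiAction_eq_of_inner_eq fun x => ?_
    have hle := jacobiMin_le_jacobiExt ha hLC t
    rw [hle.2 (x := x) (y := ⟨x, hle.1 x.2⟩) rfl, ← inner_conj_symm,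
      hadj ⟨x, hle.1 x.2⟩, inner_conj_symm]
  have hvmax : v ∈ (jacobiMax a b).domain :=
    mem_jacobiMax_domain_iff.2 ⟨lp.memℓp v, by rw [hJ]; exact lp.memℓp _⟩
  have hJv : (jacobiExt a b t).adjoint v' = jacobiMax a b ⟨v, hvmax⟩ :=
    EllTwo.toSeq_injective hJ.symm
  refine (mem_jacobiExt_domain_iff ha hLC).2 ⟨mem_jacobiMax_domain_iff.1 hvmax, ?_⟩
  obtain ⟨y, hy, hyseq⟩ : ∃ y : EllTwo, y ∈ (jacobiExt a b t).domain ∧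
      EllTwo.toSeq y = boundarySeq a b t :=
    ⟨⟨_, hb.1⟩, (mem_jacobiExt_domain_iff ha hLC).2 ⟨hb, boundaryForm_self _⟩, rfl⟩
  have h1 := hadj ⟨y, hy⟩
  have h2 := inner_jacobiMax_sub_inner ⟨v, hvmax⟩ ⟨y, jacobiExt_le_jacobiMax.1 hy⟩
  rw [← hJv, ← jacobiExt_le_jacobiMax.2 (x := ⟨y, hy⟩) rfl, h1, sub_self] at h2
  change 0 = boundaryForm a b (fun n => conj (EllTwo.toSeq v n)) (EllTwo.toSeq y) at h2
  rwa [hyseq, ← hconj, boundaryForm_conj, eq_comm, map_eq_zero] at h2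

/-! ### Boundary forms of the solutions -/

theorem scalarProd_jacobiP_conj (h : ℕ → ℂ) (z : ℂ) :
    scalarProd h (jacobiP a b (conj z)) = ∑' n, jacobiP a b z n * h n :=
  tsum_congr fun n => by rw [jacobiP_conj, Complex.conj_conj, mul_comm]

theorem scalarProd_jacobiP_zero (u : ℕ → ℂ) :
    scalarProd u (jacobiP a b 0) = ∑' n, u n * jacobiP a b 0 n :=
  tsum_congr fun n => by rw [← jacobiP_conj, map_zero]

theorem scalarProd_jacobiQ_zero (u : ℕ → ℂ) :
    scalarProd u (jacobiQ a b 0) = ∑' n, u n * jacobiQ a b 0 n :=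
  tsum_congr fun n => by rw [← jacobiQ_conj, map_zero]

theorem boundaryForm_jacobiP_jacobiP_zero (ha : ∀ n, 0 < a n) (z : ℂ) :
    boundaryForm a b (jacobiP a b z) (jacobiP a b 0) =
      -(z * scalarProd (jacobiP a b z) (jacobiP a b 0)) := by
  rw [scalarProd_jacobiP_zero, boundaryForm, ← tsum_mul_left, ← tsum_neg,
    jacobiAction_jacobiP ha, jacobiAction_jacobiP ha]
  exact tsum_congr fun n => by simp only [Pi.smul_apply, smul_eq_mul]; ring

/-- The constant 1 comes from the source term in 𝒥q(z) = z q(z) + e₀, paired with p₀ = 1. For two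
functions q it disappears because q₀ = 0. -/
theorem boundaryForm_jacobiQ_jacobiP_zero (ha : ∀ n, 0 < a n)
    (hLC : (jacobiMin a b).closure ≠ jacobiMax a b) (z : ℂ) :
    boundaryForm a b (jacobiQ a b z) (jacobiP a b 0) =
      -(1 + z * scalarProd (jacobiQ a b z) (jacobiP a b 0)) := by
  have hs := (isMaximal_jacobiQ ha hLC z).1.summable_mul (isMaximal_jacobiP ha hLC 0).1
  rw [scalarProd_jacobiP_zero, boundaryForm, jacobiAction_jacobiP ha, jacobiAction_jacobiQ ha]
  refine (((hasSum_pi_single 0 (1 : ℂ)).add (hs.hasSum.mul_left z)).neg.congr_fun ?_).tsum_eq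
  intro n
  cases n with
  | zero => simp [jacobiQ, jacobiP]
  | succ n => simp; ring

theorem boundaryForm_jacobiP_jacobiQ_zero (ha : ∀ n, 0 < a n)
    (hLC : (jacobiMin a b).closure ≠ jacobiMax a b) (z : ℂ) :
    boundaryForm a b (jacobiP a b z) (jacobiQ a b 0) =
      1 - z * scalarProd (jacobiP a b z) (jacobiQ a b 0) := by
  have hs := (isMaximal_jacobiP ha hLC z).1.summable_mul (isMaximal_jacobiQ ha hLC 0).1
  rw [scalarProd_jacobiQ_zero, boundaryForm, jacobiAction_jacobiP ha, jacobiAction_jacobiQ ha]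
  refine (((hasSum_pi_single 0 (1 : ℂ)).sub (hs.hasSum.mul_left z)).congr_fun ?_).tsum_eq
  intro n
  cases n with
  | zero => simp [jacobiQ, jacobiP]
  | succ n => simp; ring

theorem boundaryForm_jacobiQ_jacobiQ_zero (ha : ∀ n, 0 < a n) (z : ℂ) :
    boundaryForm a b (jacobiQ a b z) (jacobiQ a b 0) =
      -(z * scalarProd (jacobiQ a b z) (jacobiQ a b 0)) := by
  rw [scalarProd_jacobiQ_zero, boundaryForm, ← tsum_mul_left, ← tsum_neg,
    jacobiAction_jacobiQ ha, jacobiAction_jacobiQ ha]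
  refine tsum_congr fun n => ?_
  cases n with
  | zero => simp [jacobiQ]
  | succ n => simp; ring

theorem boundaryForm_jacobiP_boundarySeq_coe (ha : ∀ n, 0 < a n)
    (hLC : (jacobiMin a b).closure ≠ jacobiMax a b) (z : ℂ) (s : ℝ) :
    boundaryForm a b (jacobiP a b z) (boundarySeq a b (s : OnePoint ℝ)) =
      1 - z * scalarProd (jacobiP a b z) (jacobiQ a b 0) -
        z * scalarProd (jacobiP a b z) (jacobiP a b 0) * s := by
  rw [boundarySeq_coe, boundaryForm_add_right (isMaximal_jacobiP ha hLC z)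
    ((isMaximal_jacobiP ha hLC 0).smul _) (isMaximal_jacobiQ ha hLC 0), boundaryForm_smul_right,
    boundaryForm_jacobiP_jacobiP_zero ha, boundaryForm_jacobiP_jacobiQ_zero ha hLC]
  ring

theorem boundaryForm_jacobiQ_boundarySeq_coe (ha : ∀ n, 0 < a n)
    (hLC : (jacobiMin a b).closure ≠ jacobiMax a b) (z : ℂ) (s : ℝ) :
    boundaryForm a b (jacobiQ a b z) (boundarySeq a b (s : OnePoint ℝ)) =
      -(z * scalarProd (jacobiQ a b z) (jacobiQ a b 0) +
          (1 + z * scalarProd (jacobiQ a b z) (jacobiP a b 0)) * s) := by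
  rw [boundarySeq_coe, boundaryForm_add_right (isMaximal_jacobiQ ha hLC z)
    ((isMaximal_jacobiP ha hLC 0).smul _) (isMaximal_jacobiQ ha hLC 0), boundaryForm_smul_right,
    boundaryForm_jacobiQ_jacobiP_zero ha hLC, boundaryForm_jacobiQ_jacobiQ_zero ha]
  ring

/-- Non-real numbers are not eigenvalues of the self-adjoint extensions. -/
theorem boundaryForm_jacobiP_boundarySeq_ne_zero (ha : ∀ n, 0 < a n)
    (hLC : (jacobiMin a b).closure ≠ jacobiMax a b) {z : ℂ} (hz : z.im ≠ 0) (t : OnePoint ℝ) :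
    boundaryForm a b (jacobiP a b z) (boundarySeq a b t) ≠ 0 := by
  intro h0
  have hp := isMaximal_jacobiP ha hLC z
  -- The boundary sequence is real, so the conjugate solution satisfies the same condition; pairing
  -- the two gives (z - z̄)‖p(z)‖² = 0, although p₀ = 1.
  have h1 : boundaryForm a b (jacobiP a b (conj z)) (boundarySeq a b t) = 0 := by
    have hp' : jacobiP a b (conj z) = fun n => conj (jacobiP a b z n) := funext (jacobiP_conj z)
    have hb : boundarySeq a b t = fun n => conj (boundarySeq a b t n) :=
      funext fun n => (boundarySeq_conj n).symm
    rw [hp', hb, boundaryForm_conj, h0, map_zero]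
  have h := boundaryForm_eq_zero ha hLC (isMaximal_jacobiP ha hLC (conj z)) hp h1 h0
  have hsum := (memℓp_two_iff_summable _).1 hp.1
  have key : boundaryForm a b (jacobiP a b (conj z)) (jacobiP a b z) =
      (z - conj z) * ((∑' n, ‖jacobiP a b z n‖ ^ 2 : ℝ) : ℂ) := by
    rw [boundaryForm, Complex.ofReal_tsum, ← tsum_mul_left, jacobiAction_jacobiP ha,
      jacobiAction_jacobiP ha]
    refine tsum_congr fun n => ?_
    rw [Complex.ofReal_pow, ← Complex.conj_mul', ← jacobiP_conj]
    simp only [Pi.smul_apply, smul_eq_mul]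
    ring
  rw [h, eq_comm, mul_eq_zero, sub_eq_zero] at key
  rcases key with h2 | h2
  · exact hz (Complex.conj_eq_iff_im.1 h2.symm)
  · have h3 : (1 : ℝ) ≤ ∑' n, ‖jacobiP a b z n‖ ^ 2 := by
      have := hsum.le_tsum 0 fun n _ => by positivity
      simpa [jacobiP] using this
    have h4 := Complex.ofReal_eq_zero.1 h2
    linarith

/-- This is what singles out γ: it makes γ p(z) + q(z) satisfy the boundary condition at infinity.
-/
theorem resolventCoeff_mul_add (ha : ∀ n, 0 < a n)
    (hLC : (jacobiMin a b).closure ≠ jacobiMax a b) {z : ℂ} (hz : z.im ≠ 0) (t : OnePoint ℝ) :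
    resolventCoeff a b z t * boundaryForm a b (jacobiP a b z) (boundarySeq a b t) +
      boundaryForm a b (jacobiQ a b z) (boundarySeq a b t) = 0 := by
  have hne := boundaryForm_jacobiP_boundarySeq_ne_zero ha hLC hz t
  induction t using OnePoint.rec with
  | infty =>
    rw [boundarySeq_infty, boundaryForm_jacobiP_jacobiP_zero ha] at hne
    rw [boundarySeq_infty, boundaryForm_jacobiP_jacobiP_zero ha,
      boundaryForm_jacobiQ_jacobiP_zero ha hLC]
    change -(_ / _) * _ + _ = 0
    rw [neg_mul_neg, div_mul_cancel₀ _ (neg_ne_zero.1 hne)]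
    ring
  | coe s =>
    rw [boundaryForm_jacobiP_boundarySeq_coe ha hLC] at hne ⊢
    rw [boundaryForm_jacobiQ_boundarySeq_coe ha hLC]
    change _ / _ * _ + _ = 0
    rw [div_mul_cancel₀ _ hne]
    ring

end

/-! ### The quasiresolvent -/

section

variable {a b : ℕ → ℝ} {z : ℂ}

theorem tsum_tail_eq {f : ℕ → ℂ} (hf : Summable f) (n : ℕ) :
    ∑' m, f (n + m) = f n + ∑' m, f (n + 1 + m) := by
  have h : Summable fun m => f (n + m) := by
    simpa only [add_comm n] using (summable_nat_add_iff n).2 hf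
  rw [h.tsum_eq_zero_add, add_zero]
  exact congrArg (f n + ·) (tsum_congr fun m => congrArg f (by ring))

/-- The term m = n + 1 carries the factor q p in either sum, so the cut may be moved. The entries at
n and n + 1 then have the same coefficients along q and p, and Wronskians can be computed linearly.
-/
theorem quasiResolvent_apply_succ (h : ℕ → ℂ)
    (hs : Summable fun m => jacobiQ a b z m * h m) (n : ℕ) :
    quasiResolvent a b z h (n + 1) =
      jacobiQ a b z (n + 1) * ∑ m ∈ Finset.range (n + 1), jacobiP a b z m * h m +
        jacobiP a b z (n + 1) * ∑' m : ℕ, jacobiQ a b z (n + 1 + m) * h (n + 1 + m) := by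
  rw [quasiResolvent, Finset.sum_range_succ, tsum_tail_eq hs (n + 1)]
  ring

/-- Variation of constants: with the cut aligned at three consecutive indices the recurrences for p
and q cancel all but one term, which the unit Wronskian turns into h. -/
theorem jacobiAction_quasiResolvent (ha : ∀ n, 0 < a n) (h : ℕ → ℂ)
    (hs : Summable fun m => jacobiQ a b z m * h m) :
    jacobiAction a b (quasiResolvent a b z h) = z • quasiResolvent a b z h + h := by
  funext n
  cases n with
  | zero =>
    have hp := congrFun (jacobiAction_jacobiP (b := b) ha z) 0
    have hq := jacobiAction_jacobiQ_zero (b := b) ha z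
    rw [Pi.smul_apply, smul_eq_mul, jacobiAction_zero] at hp
    rw [jacobiAction_zero] at hq
    have h1 := quasiResolvent_apply_succ h hs 0
    rw [zero_add] at h1
    rw [jacobiAction_zero, h1, Pi.add_apply, Pi.smul_apply, smul_eq_mul, quasiResolvent]
    simp only [zero_add, Finset.range_one, Finset.sum_singleton]
    have hp0 : jacobiP a b z 0 = 1 := rfl
    have hq0 : jacobiQ a b z 0 = 0 := rfl
    rw [hp0] at hp ⊢
    rw [hq0] at hq ⊢
    linear_combination (h 0) * hq + (∑' m, jacobiQ a b z (1 + m) * h (1 + m)) * hp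
  | succ n =>
    have hp := congrFun (jacobiAction_jacobiP (b := b) ha z) (n + 1)
    have hq := jacobiAction_jacobiQ_succ (b := b) ha z n
    have hW := wronskian_jacobiP_jacobiQ (b := b) ha z n
    rw [Pi.smul_apply, smul_eq_mul, jacobiAction_succ] at hp
    rw [jacobiAction_succ] at hq
    rw [wronskian] at hW
    have h1 := quasiResolvent_apply_succ h hs (n + 1)
    have h0 : quasiResolvent a b z h n = jacobiQ a b z n *
        ∑ m ∈ Finset.range (n + 1), jacobiP a b z m * h m +
        jacobiP a b z n * (jacobiQ a b z (n + 1) * h (n + 1) +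
          ∑' m : ℕ, jacobiQ a b z (n + 1 + 1 + m) * h (n + 1 + 1 + m)) := by
      rw [quasiResolvent, tsum_tail_eq hs (n + 1)]
    rw [jacobiAction_succ, h1, h0, Pi.add_apply, Pi.smul_apply, smul_eq_mul, quasiResolvent,
      Finset.sum_range_succ _ (n + 1)]
    linear_combination (h (n + 1)) * hW +
      (∑' m, jacobiQ a b z (n + 1 + 1 + m) * h (n + 1 + 1 + m)) * hp +
      (∑ m ∈ Finset.range (n + 1), jacobiP a b z m * h m +
        jacobiP a b z (n + 1) * h (n + 1)) * hq

/-- The Wronskian of the quasiresolvent with a sequence converges to a multiple of the boundary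
form of `q(z)`. -/
theorem tendsto_wronskian_quasiResolvent {h v : ℕ → ℂ} (hv : IsMaximal a b v)
    (hp : IsMaximal a b (jacobiP a b z)) (hq : IsMaximal a b (jacobiQ a b z))
    (hh : Memℓp (E := fun _ : ℕ => ℂ) h 2) :
    Filter.Tendsto (wronskian a (quasiResolvent a b z h) v) Filter.atTop
      (nhds ((∑' n, jacobiP a b z n * h n) * boundaryForm a b (jacobiQ a b z) v)) := by
  have hs := hq.1.summable_mul hh
  have hS := (Filter.tendsto_add_atTop_iff_nat 1).2 (hp.1.summable_mul hh).hasSum.tendsto_sum_nat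
  have hT : Filter.Tendsto (fun n => ∑' m, jacobiQ a b z (n + 1 + m) * h (n + 1 + m))
      Filter.atTop (nhds 0) := by
    have h1 := (Filter.tendsto_add_atTop_iff_nat 1).2
      (tendsto_sum_nat_add fun m => jacobiQ a b z m * h m)
    refine h1.congr fun n => tsum_congr fun m => ?_
    rw [add_comm m]
  have hlim := (hS.mul (hq.tendsto_wronskian hv)).add (hT.mul (hp.tendsto_wronskian hv))
  rw [zero_mul, add_zero] at hlim
  refine hlim.congr fun n => ?_
  simp only [wronskian]
  rw [quasiResolvent_apply_succ h hs n, quasiResolvent]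
  ring

/-! ### Boundedness of the quasiresolvent and the resolvent formula -/

theorem norm_quasiResolvent_le (hp : Memℓp (E := fun _ : ℕ => ℂ) (jacobiP a b z) 2)
    (hq : Memℓp (E := fun _ : ℕ => ℂ) (jacobiQ a b z) 2) (h : EllTwo) (n : ℕ) :
    ‖quasiResolvent a b z h n‖ ≤ ‖jacobiQ a b z n‖ * (‖(⟨_, hp⟩ : EllTwo)‖ * ‖h‖) +
      ‖jacobiP a b z n‖ * (‖(⟨_, hq⟩ : EllTwo)‖ * ‖h‖) := by
  have hpq : (2 : ENNReal).toReal.HolderConjugate (2 : ENNReal).toReal := by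
    rw [ENNReal.toReal_ofNat]
    exact Real.HolderConjugate.two_two
  obtain ⟨hs1, hb1⟩ := lp.tsum_mul_le_mul_norm hpq (⟨_, hp⟩ : EllTwo) h
  obtain ⟨hs2, hb2⟩ := lp.tsum_mul_le_mul_norm hpq (⟨_, hq⟩ : EllTwo) h
  rw [quasiResolvent]
  refine (norm_add_le _ _).trans ?_
  rw [norm_mul, norm_mul]
  gcongr
  · refine (norm_sum_le _ _).trans (le_trans ?_ hb1)
    simp only [norm_mul]
    exact hs1.sum_le_tsum (Finset.range (n + 1)) fun m _ => by positivity
  · have hs2' := (summable_nat_add_iff (n + 1)).2 hs2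
    have hfun : (fun m => jacobiQ a b z (n + 1 + m) * h (n + 1 + m)) =
        fun m => jacobiQ a b z (m + (n + 1)) * h (m + (n + 1)) := by
      funext m
      rw [add_comm m]
    rw [hfun]
    refine (norm_tsum_le_tsum_norm (by simpa only [norm_mul] using hs2')).trans
      (le_trans ?_ hb2)
    simp only [norm_mul]
    rw [← hs2.sum_add_tsum_nat_add (n + 1)]
    exact le_add_of_nonneg_left (Finset.sum_nonneg fun m _ => by positivity)

theorem quasiResolvent_add (hq : Memℓp (E := fun _ : ℕ => ℂ) (jacobiQ a b z) 2) (g h : EllTwo)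
    (n : ℕ) : quasiResolvent a b z (g + h : EllTwo) n =
      quasiResolvent a b z g n + quasiResolvent a b z h n := by
  have hs : ∀ h : EllTwo, Summable fun m => jacobiQ a b z (n + 1 + m) * h (n + 1 + m) :=
    fun h => by
      simpa only [add_comm (n + 1)] using
        (summable_nat_add_iff (n + 1)).2 (hq.summable_mul (lp.memℓp h))
  simp only [quasiResolvent, lp.coeFn_add, Pi.add_apply, mul_add, Finset.sum_add_distrib,
    (hs g).tsum_add (hs h)]
  ring

theorem quasiResolvent_smul (c : ℂ) (h : EllTwo) (n : ℕ) :
    quasiResolvent a b z (c • h : EllTwo) n = c * quasiResolvent a b z h n := by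
  simp only [quasiResolvent, lp.coeFn_smul, Pi.smul_apply, smul_eq_mul, mul_left_comm _ c,
    ← Finset.mul_sum, tsum_mul_left]
  ring

theorem memℓp_quasiResolvent (hp : Memℓp (E := fun _ : ℕ => ℂ) (jacobiP a b z) 2)
    (hq : Memℓp (E := fun _ : ℕ => ℂ) (jacobiQ a b z) 2) (h : EllTwo) :
    Memℓp (E := fun _ : ℕ => ℂ) (quasiResolvent a b z h) 2 := by
  refine Memℓp.of_norm_le ?_ (Filter.Eventually.of_forall (norm_quasiResolvent_le hp hq h))
  set A := ‖(⟨_, hp⟩ : EllTwo)‖ * ‖h‖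
  set B := ‖(⟨_, hq⟩ : EllTwo)‖ * ‖h‖
  refine Summable.congr ((((hq.summable_norm_mul hq).mul_left (A ^ 2)).add
    ((hp.summable_norm_mul hp).mul_left (B ^ 2))).add
    ((hp.summable_norm_mul hq).mul_left (2 * A * B))) fun n => ?_
  ring

/-- The quasiresolvent as a bounded operator. -/
noncomputable def quasiResolventCLM (hp : Memℓp (E := fun _ : ℕ => ℂ) (jacobiP a b z) 2)
    (hq : Memℓp (E := fun _ : ℕ => ℂ) (jacobiQ a b z) 2) : EllTwo →L[ℂ] EllTwo :=
  LinearMap.mkContinuous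
    { toFun := fun h => ⟨quasiResolvent a b z h, memℓp_quasiResolvent hp hq h⟩
      map_add' := fun g h => lp.ext (funext (quasiResolvent_add hq g h))
      map_smul' := fun c h => lp.ext (funext (quasiResolvent_smul c h)) }
    (2 * (‖(⟨_, hp⟩ : EllTwo)‖ * ‖(⟨_, hq⟩ : EllTwo)‖)) fun h => by
      set p : EllTwo := ⟨_, hp⟩
      set q : EllTwo := ⟨_, hq⟩
      have hn : ∀ u : EllTwo, Memℓp (E := fun _ : ℕ => ℝ) (fun n => ‖u n‖) 2 := fun u => by
        refine (memℓp_gen_iff (by simp)).2 ?_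
        simpa using (memℓp_two_iff_summable _).1 (lp.memℓp u)
      -- Taking absolute values coordinatewise preserves the norm and makes the pointwise bound a
      -- vector of real ℓ², to which the triangle inequality applies.
      let N : EllTwo → lp (fun _ : ℕ => ℝ) 2 := fun u => ⟨_, hn u⟩
      have hN : ∀ u, ‖N u‖ = ‖u‖ := fun u =>
        le_antisymm (lp.norm_mono (by simp) fun n => (norm_norm (u n)).le)
          (lp.norm_mono (by simp) fun n => (norm_norm (u n)).ge)
      have hle := lp.norm_mono (p := 2) (by simp)
        (x := (⟨quasiResolvent a b z h, memℓp_quasiResolvent hp hq h⟩ : EllTwo))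
        (y := (‖p‖ * ‖h‖) • N q + (‖q‖ * ‖h‖) • N p) fun n => by
          refine (norm_quasiResolvent_le hp hq h n).trans (le_trans (le_of_eq ?_)
            (le_abs_self _))
          change _ = (‖p‖ * ‖h‖) * ‖jacobiQ a b z n‖ + (‖q‖ * ‖h‖) * ‖jacobiP a b z n‖
          ring
      refine hle.trans ((norm_add_le _ _).trans (le_of_eq ?_))
      rw [norm_smul, norm_smul, hN, hN]
      simp only [norm_mul, norm_norm]
      ring

/-- The resolvent of a self-adjoint extension. -/
theorem exists_isResolventAt_jacobiExt (ha : ∀ n, 0 < a n)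
    (hLC : (jacobiMin a b).closure ≠ jacobiMax a b) (hz : z.im ≠ 0) (t : OnePoint ℝ) :
    ∃ R : EllTwo →L[ℂ] EllTwo, IsResolventAt (jacobiExt a b t) z R ∧
      ∀ (h : EllTwo) (n : ℕ),
        R h n = resolventCoeff a b z t * scalarProd h (jacobiP a b (conj z)) * jacobiP a b z n +
          quasiResolvent a b z h n := by
  have hb := isMaximal_boundarySeq ha hLC t
  have hp := isMaximal_jacobiP ha hLC z
  have hq := isMaximal_jacobiQ ha hLC z
  have hne := boundaryForm_jacobiP_boundarySeq_ne_zero ha hLC hz t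
  set p : EllTwo := ⟨jacobiP a b z, hp.1⟩
  set p' : EllTwo := ⟨jacobiP a b (conj z), (isMaximal_jacobiP ha hLC (conj z)).1⟩
  set R : EllTwo →L[ℂ] EllTwo :=
    (resolventCoeff a b z t • innerSL ℂ p').smulRight p + quasiResolventCLM hp.1 hq.1 with hR
  have hinner : ∀ h : EllTwo, inner ℂ p' h = scalarProd h (jacobiP a b (conj z)) := fun h => by
    rw [EllTwo.inner_eq_tsum]
    exact tsum_congr fun n => mul_comm _ _
  have hRseq : ∀ h : EllTwo, EllTwo.toSeq (R h) =
      (resolventCoeff a b z t * scalarProd h (jacobiP a b (conj z))) • jacobiP a b z +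
        quasiResolvent a b z h := fun h => by
    rw [← hinner]
    rfl
  have hRact : ∀ h : EllTwo, jacobiAction a b (EllTwo.toSeq (R h)) =
      z • EllTwo.toSeq (R h) + EllTwo.toSeq h := fun h => by
    rw [hRseq, map_add, map_smul, jacobiAction_jacobiP ha,
      jacobiAction_quasiResolvent ha h (hq.1.summable_mul (lp.memℓp h)), smul_add, smul_comm z,
      add_assoc]
    rfl
  have hRmem : ∀ h : EllTwo, R h ∈ (jacobiExt a b t).domain := fun h => by
    have hact := hRact h
    have hQ : IsMaximal a b (quasiResolvent a b z h) := by
      refine ⟨memℓp_quasiResolvent hp.1 hq.1 h, ?_⟩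
      rw [jacobiAction_quasiResolvent ha h (hq.1.summable_mul (lp.memℓp h))]
      exact ((memℓp_quasiResolvent hp.1 hq.1 h).const_smul z).add (lp.memℓp h)
    have hform := tendsto_nhds_unique (hQ.tendsto_wronskian hb)
      (tendsto_wronskian_quasiResolvent hb hp hq (lp.memℓp h))
    rw [mem_jacobiExt_domain_iff ha hLC, hRseq]
    refine ⟨(hp.smul _).add hQ, ?_⟩
    rw [boundaryForm_add_left (hp.smul _) hQ hb, boundaryForm_smul_left, hform,
      scalarProd_jacobiP_conj]
    linear_combination (∑' n, jacobiP a b z n * h n) * resolventCoeff_mul_add ha hLC hz t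
  have hright : ∀ h : EllTwo, jacobiExt a b t ⟨R h, hRmem h⟩ - z • R h = h := fun h => by
    refine EllTwo.toSeq_injective ?_
    rw [map_sub, map_smul, toSeq_jacobiExt, hRact, add_sub_cancel_left]
  refine ⟨R, ⟨fun h => ⟨hRmem h, hright h⟩, fun u => ?_⟩, fun h n => congrFun (hRseq h) n⟩
  set f := jacobiExt a b t u - z • (u : EllTwo) with hf
  -- The difference is an eigenvector candidate for z, hence a multiple of p(z); since p(z) violates
  -- the boundary condition, the multiple is zero.
  have hdmem : R f - u ∈ (jacobiExt a b t).domain := sub_mem (hRmem f) u.2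
  have hdact : jacobiAction a b (EllTwo.toSeq (R f - u)) = z • EllTwo.toSeq (R f - u) := by
    have hfseq : EllTwo.toSeq f =
        jacobiAction a b (EllTwo.toSeq u) - z • EllTwo.toSeq u := by
      rw [hf, map_sub, map_smul, toSeq_jacobiExt]
    rw [map_sub, map_sub, hRact, hfseq, smul_sub]
    abel
  obtain ⟨-, hd0⟩ := (mem_jacobiExt_domain_iff ha hLC).1 hdmem
  have hd := eq_smul_jacobiP ha hdact
  rw [hd, boundaryForm_smul_left] at hd0
  rw [(mul_eq_zero.1 hd0).resolve_right hne, zero_smul] at hd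
  exact sub_eq_zero.1 (EllTwo.toSeq_injective (hd.trans (map_zero _).symm))

/-- The determinant of the Möbius function `t ↦ γ_t(z)` equals one. -/
theorem resolventCoeff_det (ha : ∀ n, 0 < a n)
    (hLC : (jacobiMin a b).closure ≠ jacobiMax a b) (z : ℂ) :
    (1 + z * scalarProd (jacobiQ a b z) (jacobiP a b 0)) *
        (1 - z * scalarProd (jacobiP a b z) (jacobiQ a b 0)) +
      (z * scalarProd (jacobiQ a b z) (jacobiQ a b 0)) *
        (z * scalarProd (jacobiP a b z) (jacobiP a b 0)) = 1 := by
  have h := boundaryForm_mul_boundaryForm (isMaximal_jacobiP ha hLC z)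
    (isMaximal_jacobiQ ha hLC z) (isMaximal_jacobiP ha hLC 0) (isMaximal_jacobiQ ha hLC 0)
  rw [boundaryForm_jacobiP_jacobiQ ha hLC, boundaryForm_jacobiP_jacobiQ ha hLC,
    boundaryForm_jacobiP_jacobiP_zero ha, boundaryForm_jacobiQ_jacobiP_zero ha hLC,
    boundaryForm_jacobiP_jacobiQ_zero ha hLC, boundaryForm_jacobiQ_jacobiQ_zero ha] at h
  linear_combination -h

end

theorem theorem2p5 (a b : ℕ → ℝ) (ha : ∀ n, 0 < a n)
    (hLC : (jacobiMin a b).closure ≠ jacobiMax a b) :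
    -- `p(z)` and `q(z)` lie in `ℓ²`, so every series in the formulas converges absolutely
    (∀ z : ℂ, Memℓp (E := fun _ : ℕ => ℂ) (jacobiP a b z) 2 ∧
      Memℓp (E := fun _ : ℕ => ℂ) (jacobiQ a b z) 2) ∧
    -- `J_t` is a self-adjoint extension of the minimal operator with the prescribed domain
    (∀ t : OnePoint ℝ,
      jacobiMin a b ≤ jacobiExt a b t ∧
      (jacobiExt a b t).domain = (jacobiMin a b).closure.domain ⊔ boundarySpan a b t ∧
      Disjoint (jacobiMin a b).closure.domain (boundarySpan a b t) ∧
      IsSelfAdjoint (jacobiExt a b t)) ∧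
    ∀ z : ℂ, z.im ≠ 0 →
      -- the denominators of `γ_t(z)`, `t ∈ ℝ`, and of `γ_∞(z)` do not vanish
      (∀ s : ℝ, 1 - z * scalarProd (jacobiP a b z) (jacobiQ a b 0) -
        z * scalarProd (jacobiP a b z) (jacobiP a b 0) * s ≠ 0) ∧
      z * scalarProd (jacobiP a b z) (jacobiP a b 0) ≠ 0 ∧
      -- the fractional linear function `t ↦ γ_t(z)` is nondegenerate
      (1 + z * scalarProd (jacobiQ a b z) (jacobiP a b 0)) *
          (1 - z * scalarProd (jacobiP a b z) (jacobiQ a b 0)) +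
        (z * scalarProd (jacobiQ a b z) (jacobiQ a b 0)) *
          (z * scalarProd (jacobiP a b z) (jacobiP a b 0)) ≠ 0 ∧
      -- the resolvent exists and is given by the formula
      ∀ t : OnePoint ℝ, ∃ R : EllTwo →L[ℂ] EllTwo,
        IsResolventAt (jacobiExt a b t) z R ∧
        ∀ (h : EllTwo) (n : ℕ),
          R h n = resolventCoeff a b z t * scalarProd h (jacobiP a b (conj z)) * jacobiP a b z n +
            quasiResolvent a b z h n := by
  refine ⟨fun z => ⟨(isMaximal_jacobiP ha hLC z).1, (isMaximal_jacobiQ ha hLC z).1⟩,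
    fun t => ⟨jacobiMin_le_jacobiExt ha hLC t, jacobiExt_domain a b ha hLC t,
      disjoint_closure_domain_boundarySpan ha hLC t, isSelfAdjoint_jacobiExt ha hLC t⟩,
    fun z hz => ⟨fun s => ?_, ?_, ?_, exists_isResolventAt_jacobiExt ha hLC hz⟩⟩
  · rw [← boundaryForm_jacobiP_boundarySeq_coe ha hLC]
    exact boundaryForm_jacobiP_boundarySeq_ne_zero ha hLC hz s
  · rw [← neg_ne_zero, ← boundaryForm_jacobiP_jacobiP_zero ha, ← boundarySeq_infty]
    exact boundaryForm_jacobiP_boundarySeq_ne_zero ha hLC hz OnePoint.infty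
  · rw [resolventCoeff_det ha hLC]
    exact one_ne_zero
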